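/- Let $G$ be a finite group and let $T$ be a $G$-Tambara functor, given by commutative rings $T(G/H)$ for $H\le G$ with restrictions $r^H_K$, transfers $t^H_K$ and norms $N^H_K$ for $K\le H\le G$, and conjugation isomorphisms $c_{g,H}\colon T(G/H)\to T(G/gHg^{-1})$. A Tambara ideal $I$ of $T$ is a family of ring ideals $I(G/H)\subseteq T(G/H)$, $H\le G$, that is closed under all restrictions, transfers and norms and satisfies $c_{g,H}(I(G/H))=I(G/gHg^{-1})$. The intersection of Tambara ideals is taken levelwise. The product $IJ$ of two Tambara ideals is the smallest Tambara ideal that contains $I(G/H)\cdot J(G/H)$ for all $H\le G$; $I^n$ denotes the $n$-fold product of $I$ with itself. For $x\in T(G/H)$, $\langle x\rangle$ denotes the smallest Tambara ideal with $x\in\langle x\rangle(G/H)$. The radical of $I$ is the Tambara ideal $\sqrt I$ given by \[ (\sqrt I)(G/H)=\{x\in T(G/H)\mid \langle x\rangle^n\subseteq I\text{ for some }n\ge 1\}. \] Then for all Tambara ideals $I$ and $J$ of $T$, \[ \sqrt{IJ}=\sqrt I\cap\sqrt J . \] -/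

import Mathlib

universe u v

/-- The conjugate subgroup `g H g⁻¹`. -/
abbrev conjSubgroup {G : Type v} [Group G] (g : G) (H : Subgroup G) : Subgroup G :=
  H.map (MulAut.conj g).toMonoidHom

/-- `S` contains exactly one element of each class of the (equivalence) relation `r`. -/
def IsTransversal {α : Type v} (r : α → α → Prop) (S : Finset α) : Prop :=
  ∀ a, ∃! s, s ∈ S ∧ r a s

/-- For subgroups `L, H ≤ K`: `S` is a complete system of representatives of the double cosets
`L \ K / H`. -/
def IsDoubleCosetReps {G : Type v} [Group G] (L K H : Subgroup G) (S : Finset K) : Prop :=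
  IsTransversal (fun x y : K => ∃ l ∈ L, ∃ h ∈ H, (y : G) = l * x * h) S

/-- For `K ≤ H`: the set of maps `H/K → {true, false}`, presented as the functions on `H` that are
constant on left cosets of `K`. -/
structure Coloring {G : Type v} [Group G] (H K : Subgroup G) where
  toFun : H → Bool
  const : ∀ x y : H, (x : G)⁻¹ * y ∈ K → toFun x = toFun y

namespace Coloring

variable {G : Type v} [Group G] {H K : Subgroup G}

/-- `F'` is a translate of `F` under the action `(h • F)(y) = F (h⁻¹ y)` of `H`. -/
def SameOrbit (F F' : Coloring H K) : Prop :=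
  ∃ h : H, ∀ x : H, F'.toFun (h * x) = F.toFun x

/-- The stabilizer of `F` in `H`, as a subgroup of `G`. -/
def stab (F : Coloring H K) : Subgroup G :=
  Subgroup.map H.subtype
    { carrier := {h : H | ∀ x : H, F.toFun (h * x) = F.toFun x}
      one_mem' := fun x => by rw [one_mul]
      mul_mem' := fun {a b} ha hb x => by rw [mul_assoc, ha, hb]
      inv_mem' := fun {a} ha x => by rw [← ha (a⁻¹ * x), mul_inv_cancel_left] }

theorem stab_le (F : Coloring H K) : F.stab ≤ H := by
  rintro _ ⟨h, -, rfl⟩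
  exact h.2

end Coloring

/-- For `L ≤ K ≤ H`: (lifts to `H` of) the sections of the projection `H/L → H/K`. The function
`toFun` sends `x` to an element of `H` whose class mod `L` is the value of the section at `xK`. -/
structure CosetSection {G : Type v} [Group G] (H K L : Subgroup G) where
  toFun : H → H
  isSection : ∀ x : H, (x : G)⁻¹ * toFun x ∈ K
  const : ∀ x y : H, (x : G)⁻¹ * y ∈ K → (toFun x : G)⁻¹ * toFun y ∈ L

namespace CosetSection

variable {G : Type v} [Group G] {H K L : Subgroup G}

/-- The section of `s'` is a translate of the section of `s` under the action
`(h • s)(y) = h s(h⁻¹ y)` of `H`; values are compared modulo `L`. -/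
def SameOrbit (s s' : CosetSection H K L) : Prop :=
  ∃ h : H, ∀ x : H, (s'.toFun (h * x) : G)⁻¹ * (h * s.toFun x) ∈ L

/-- The stabilizer in `H` of the section of `s`, as a subgroup of `G`. -/
def stab (s : CosetSection H K L) : Subgroup G :=
  Subgroup.map H.subtype
    { carrier := {h : H | ∀ x : H, (s.toFun (h * x) : G)⁻¹ * (h * s.toFun x) ∈ L}
      one_mem' := fun x => by simp
      mul_mem' := fun {a b} ha hb x => by
        have := L.mul_mem (ha (b * x)) (hb x)
        simpa [mul_assoc] using this
      inv_mem' := fun {a} ha x => by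
        have := L.inv_mem (ha (a⁻¹ * x))
        simpa [mul_assoc] using this }

theorem stab_le (s : CosetSection H K L) : s.stab ≤ H := by
  rintro _ ⟨h, -, rfl⟩
  exact h.2

theorem stab_inf_le (s : CosetSection H K L) (γ : H) :
    s.stab ⊓ conjSubgroup (γ : G) K ≤ conjSubgroup (s.toFun γ : G) L := by
  rintro _ ⟨⟨h, hh, rfl⟩, ⟨k, hk, hk'⟩⟩
  have e : (h : G) = γ * k * (γ : G)⁻¹ := by simpa using hk'.symm
  have h1 := hh γ
  have h2 := s.const γ (h * γ) (by simpa [e] using hk)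
  refine ⟨(s.toFun γ : G)⁻¹ * (h * s.toFun γ), ?_, ?_⟩
  · have := L.mul_mem h2 h1
    simpa [mul_assoc] using this
  · simp [mul_assoc]

end CosetSection

/-- A `G`-Tambara functor for a finite group `G`, given by its values `obj H = T(G/H)` with
restrictions `res`, transfers `tr`, norms `norm` and conjugations
`conj g : T(G/H) ≅ T(G/gHg⁻¹)`.
To avoid transport along equalities of subgroups, `conj g` takes its target `K` together with a
proof that `K = g H g⁻¹`. -/
structure TambaraFunctor (G : Type v) [Group G] where
  obj : Subgroup G → Type u
  [ring : ∀ H, CommRing (obj H)]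
  res : ∀ {K H : Subgroup G}, K ≤ H → (obj H →+* obj K)
  tr : ∀ {K H : Subgroup G}, K ≤ H → (obj K →+ obj H)
  norm : ∀ {K H : Subgroup G}, K ≤ H → (obj K →* obj H)
  conj : ∀ (g : G) {H K : Subgroup G}, K = conjSubgroup g H → (obj H ≃+* obj K)
  -- functoriality
  res_refl : ∀ {H : Subgroup G} (x : obj H), res (le_refl H) x = x
  tr_refl : ∀ {H : Subgroup G} (x : obj H), tr (le_refl H) x = x
  norm_refl : ∀ {H : Subgroup G} (x : obj H), norm (le_refl H) x = x
  res_res : ∀ {L K H : Subgroup G} (h₁ : L ≤ K) (h₂ : K ≤ H) (x : obj H),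
    res h₁ (res h₂ x) = res (h₁.trans h₂) x
  tr_tr : ∀ {L K H : Subgroup G} (h₁ : L ≤ K) (h₂ : K ≤ H) (x : obj L),
    tr h₂ (tr h₁ x) = tr (h₁.trans h₂) x
  norm_norm : ∀ {L K H : Subgroup G} (h₁ : L ≤ K) (h₂ : K ≤ H) (x : obj L),
    norm h₂ (norm h₁ x) = norm (h₁.trans h₂) x
  conj_conj : ∀ (g h : G) {H K L : Subgroup G} (e₁ : K = conjSubgroup h H)
    (e₂ : L = conjSubgroup g K) (e₃ : L = conjSubgroup (g * h) H) (x : obj H),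
    conj g e₂ (conj h e₁ x) = conj (g * h) e₃ x
  conj_of_mem : ∀ {H : Subgroup G} (g : G), g ∈ H → ∀ (e : H = conjSubgroup g H) (x : obj H),
    conj g e x = x
  -- conjugacy compatibility
  conj_res : ∀ (g : G) {K H K' H' : Subgroup G} (h : K ≤ H) (h' : K' ≤ H')
    (eK : K' = conjSubgroup g K) (eH : H' = conjSubgroup g H) (x : obj H),
    conj g eK (res h x) = res h' (conj g eH x)
  conj_tr : ∀ (g : G) {K H K' H' : Subgroup G} (h : K ≤ H) (h' : K' ≤ H')
    (eK : K' = conjSubgroup g K) (eH : H' = conjSubgroup g H) (x : obj K),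
    conj g eH (tr h x) = tr h' (conj g eK x)
  conj_norm : ∀ (g : G) {K H K' H' : Subgroup G} (h : K ≤ H) (h' : K' ≤ H')
    (eK : K' = conjSubgroup g K) (eH : H' = conjSubgroup g H) (x : obj K),
    conj g eH (norm h x) = norm h' (conj g eK x)
  -- additive double coset formula
  res_tr : ∀ {H L K : Subgroup G} (hH : H ≤ K) (hL : L ≤ K) (S : Finset K),
    IsDoubleCosetReps L K H S → ∀ a : obj H,
    res hL (tr hH a) = ∑ γ ∈ S,
      tr (inf_le_left : L ⊓ conjSubgroup (γ : G) H ≤ L) (res inf_le_right (conj (γ : G) rfl a))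
  -- multiplicative double coset formula
  res_norm : ∀ {H L K : Subgroup G} (hH : H ≤ K) (hL : L ≤ K) (S : Finset K),
    IsDoubleCosetReps L K H S → ∀ a : obj H,
    res hL (norm hH a) = ∏ γ ∈ S,
      norm (inf_le_left : L ⊓ conjSubgroup (γ : G) H ≤ L) (res inf_le_right (conj (γ : G) rfl a))
  -- Frobenius reciprocity
  tr_res_mul : ∀ {K H : Subgroup G} (h : K ≤ H) (x : obj H) (y : obj K),
    tr h (res h x * y) = x * tr h y
  -- Tambara reciprocity for sums
  norm_add : ∀ {K H : Subgroup G} (h : K ≤ H) (S : Finset (Coloring H K)),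
    IsTransversal Coloring.SameOrbit S →
    ∀ D : Coloring H K → Finset H, (∀ F ∈ S, IsDoubleCosetReps F.stab H K (D F)) →
    ∀ a b : obj K,
    norm h (a + b) = ∑ F ∈ S, tr F.stab_le (∏ γ ∈ D F,
      norm (inf_le_left : F.stab ⊓ conjSubgroup (γ : G) K ≤ F.stab)
        (res inf_le_right (conj (γ : G) rfl (bif F.toFun γ then a else b))))
  -- Tambara reciprocity for transfers
  norm_tr : ∀ {L K H : Subgroup G} (hL : L ≤ K) (hK : K ≤ H) (S : Finset (CosetSection H K L)),
    IsTransversal CosetSection.SameOrbit S →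
    ∀ D : CosetSection H K L → Finset H, (∀ s ∈ S, IsDoubleCosetReps s.stab H K (D s)) →
    ∀ a : obj L,
    norm hK (tr hL a) = ∑ s ∈ S, tr s.stab_le (∏ γ ∈ D s,
      norm (inf_le_left : s.stab ⊓ conjSubgroup (γ : G) K ≤ s.stab)
        (res (s.stab_inf_le γ) (conj (s.toFun γ : G) rfl a)))

attribute [instance] TambaraFunctor.ring

/-- A Tambara ideal of `T`. -/
structure TambaraIdeal {G : Type v} [Group G] (T : TambaraFunctor.{u, v} G) where
  level : ∀ H : Subgroup G, Ideal (T.obj H)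
  res_mem : ∀ {K H : Subgroup G} (h : K ≤ H) (x : T.obj H), x ∈ level H → T.res h x ∈ level K
  tr_mem : ∀ {K H : Subgroup G} (h : K ≤ H) (x : T.obj K), x ∈ level K → T.tr h x ∈ level H
  norm_mem : ∀ {K H : Subgroup G} (h : K ≤ H) (x : T.obj K), x ∈ level K → T.norm h x ∈ level H
  conj_image : ∀ (g : G) {H K : Subgroup G} (e : K = conjSubgroup g H),
    T.conj g e '' (level H : Set (T.obj H)) = level K

namespace TambaraFunctor

variable {G : Type v} [Group G] (T : TambaraFunctor.{u, v} G)

/-- A family of subsets that is carried into itself by all conjugations is carried onto itself. -/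
theorem conj_image_eq (P : ∀ H : Subgroup G, Set (T.obj H))
    (hP : ∀ (g : G) {H K : Subgroup G} (e : K = conjSubgroup g H) (x : T.obj H),
      x ∈ P H → T.conj g e x ∈ P K)
    (g : G) {H K : Subgroup G} (e : K = conjSubgroup g H) : T.conj g e '' P H = P K := by
  apply Set.Subset.antisymm
  · rintro _ ⟨x, hx, rfl⟩
    exact hP g e x hx
  · intro y hy
    have e' : H = conjSubgroup g⁻¹ K := by
      subst e
      ext z
      simp [mul_assoc]
    have e1 : K = conjSubgroup (g * g⁻¹) K := by
      ext z
      simp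
    refine ⟨T.conj g⁻¹ e' y, hP _ _ _ hy, ?_⟩
    rw [T.conj_conj g g⁻¹ e' e e1]
    exact T.conj_of_mem _ (by rw [mul_inv_cancel]; exact K.one_mem) _ _

end TambaraFunctor

namespace TambaraIdeal

variable {G : Type v} [Group G] {T : TambaraFunctor.{u, v} G}

@[ext]
theorem ext {I J : TambaraIdeal T} (h : ∀ H, I.level H = J.level H) : I = J := by
  cases I
  cases J
  congr
  exact funext h

theorem conj_mem (I : TambaraIdeal T) (g : G) {H K : Subgroup G} (e : K = conjSubgroup g H)
    (x : T.obj H) (hx : x ∈ I.level H) : T.conj g e x ∈ I.level K := by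
  have : T.conj g e x ∈ (I.level K : Set (T.obj K)) := by
    rw [← I.conj_image g e]
    exact ⟨x, hx, rfl⟩
  exact this

/-- Inclusion of Tambara ideals is levelwise. -/
instance : LE (TambaraIdeal T) := ⟨fun I J => ∀ H, I.level H ≤ J.level H⟩

/-- The whole functor, as a Tambara ideal. -/
instance : Top (TambaraIdeal T) where
  top :=
    { level := fun _ => ⊤
      res_mem := fun _ _ _ => Submodule.mem_top
      tr_mem := fun _ _ _ => Submodule.mem_top
      norm_mem := fun _ _ _ => Submodule.mem_top
      conj_image := T.conj_image_eq (fun H => ((⊤ : Ideal (T.obj H)) : Set (T.obj H)))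
        (fun _ _ _ _ _ _ => Submodule.mem_top) }

/-- The levelwise intersection of a set of Tambara ideals. -/
instance : InfSet (TambaraIdeal T) where
  sInf 𝒮 :=
    { level := fun H => ⨅ I ∈ 𝒮, I.level H
      res_mem := fun h x hx => by
        simp only [Submodule.mem_iInf] at hx ⊢
        exact fun I hI => I.res_mem h x (hx I hI)
      tr_mem := fun h x hx => by
        simp only [Submodule.mem_iInf] at hx ⊢
        exact fun I hI => I.tr_mem h x (hx I hI)
      norm_mem := fun h x hx => by
        simp only [Submodule.mem_iInf] at hx ⊢
        exact fun I hI => I.norm_mem h x (hx I hI)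
      conj_image := T.conj_image_eq (fun H => ((⨅ I ∈ 𝒮, I.level H : Ideal (T.obj H)) : Set _))
        (fun g _ _ e x hx => by
          simp only [SetLike.mem_coe, Submodule.mem_iInf] at hx ⊢
          exact fun I hI => I.conj_mem g e x (hx I hI)) }

/-- The levelwise intersection of two Tambara ideals. -/
instance : Min (TambaraIdeal T) where
  min I J :=
    { level := fun H => I.level H ⊓ J.level H
      res_mem := fun h x hx => ⟨I.res_mem h x hx.1, J.res_mem h x hx.2⟩
      tr_mem := fun h x hx => ⟨I.tr_mem h x hx.1, J.tr_mem h x hx.2⟩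
      norm_mem := fun h x hx => ⟨I.norm_mem h x hx.1, J.norm_mem h x hx.2⟩
      conj_image := T.conj_image_eq (fun H => {x | x ∈ I.level H ∧ x ∈ J.level H})
        (fun g _ _ e x hx => ⟨I.conj_mem g e x hx.1, J.conj_mem g e x hx.2⟩) }

/-- The Tambara ideal `⟨x⟩` generated by `x ∈ T(G/H)`: the smallest one containing `x`. -/
def principal {H : Subgroup G} (x : T.obj H) : TambaraIdeal T :=
  sInf {I | x ∈ I.level H}

/-- The product of Tambara ideals: the smallest Tambara ideal containing all the levelwise
products `I(G/H) · J(G/H)`. -/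
instance : Mul (TambaraIdeal T) where
  mul I J := sInf {P | ∀ H, I.level H * J.level H ≤ P.level H}

/-- The `n`-fold product of a Tambara ideal with itself, `I¹ = I` and `Iⁿ⁺¹ = Iⁿ · I`. -/
def ipow (I : TambaraIdeal T) : ℕ → TambaraIdeal T
  | 0 => ⊤
  | 1 => I
  | (n + 2) => ipow I (n + 1) * I

/-! The remaining facts show that the radical of a Tambara ideal is a Tambara ideal. -/

theorem sInf_le {𝒮 : Set (TambaraIdeal T)} {I : TambaraIdeal T} (h : I ∈ 𝒮) : sInf 𝒮 ≤ I := by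
  intro H x hx
  have hx' : x ∈ ⨅ I ∈ 𝒮, I.level H := hx
  simp only [Submodule.mem_iInf] at hx'
  exact hx' I h

theorem le_trans' {I J K : TambaraIdeal T} (h₁ : I ≤ J) (h₂ : J ≤ K) : I ≤ K :=
  fun H => (h₁ H).trans (h₂ H)

theorem mem_principal {H : Subgroup G} (x : T.obj H) : x ∈ (principal x).level H := by
  change x ∈ ⨅ I ∈ {I : TambaraIdeal T | x ∈ I.level H}, I.level H
  simp only [Submodule.mem_iInf]
  exact fun I hI => hI

theorem principal_le {H : Subgroup G} {x : T.obj H} {I : TambaraIdeal T} (h : x ∈ I.level H) :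
    principal x ≤ I := sInf_le h

theorem mul_le {I J P : TambaraIdeal T} (h : ∀ H, I.level H * J.level H ≤ P.level H) :
    I * J ≤ P := sInf_le h

theorem level_mul_le (I J : TambaraIdeal T) (H : Subgroup G) :
    I.level H * J.level H ≤ (I * J).level H := by
  change _ ≤ ⨅ P ∈ {P : TambaraIdeal T | ∀ H, I.level H * J.level H ≤ P.level H}, P.level H
  exact le_iInf₂ fun P hP => hP H

theorem level_pow_le (I : TambaraIdeal T) (n : ℕ) (H : Subgroup G) :
    I.level H ^ (n + 1) ≤ (I.ipow (n + 1)).level H := by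
  induction n with
  | zero => rw [zero_add, pow_one]; exact _root_.le_refl _
  | succ n ih => rw [pow_succ]; exact (Ideal.mul_mono_left ih).trans (level_mul_le _ _ H)

end TambaraIdeal

section Reps

theorem exists_transversal {α : Type v} [Finite α] (r : α → α → Prop) (hr : Equivalence r) :
    ∃ S : Finset α, IsTransversal r S := by
  classical
  let s : Setoid α := ⟨r, hr⟩
  have : Fintype (Quotient s) := Fintype.ofFinite _
  refine ⟨Finset.univ.image (Quotient.out : Quotient s → α), fun a => ?_⟩
  refine ⟨(Quotient.mk s a).out, ⟨Finset.mem_image_of_mem _ (Finset.mem_univ _),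
    hr.symm (Quotient.mk_out (s := s) a)⟩, ?_⟩
  rintro y ⟨hy, hay⟩
  obtain ⟨q, -, rfl⟩ := Finset.mem_image.1 hy
  have : Quotient.mk s a = q := by
    rw [← Quotient.out_eq q]
    exact Quotient.sound hay
  rw [this]

variable {G : Type v} [Group G] [Finite G]

theorem exists_doubleCosetReps (L K H : Subgroup G) :
    ∃ S : Finset K, IsDoubleCosetReps L K H S := by
  apply exists_transversal
  refine ⟨fun x => ⟨1, L.one_mem, 1, H.one_mem, by simp⟩, ?_, ?_⟩
  · rintro x y ⟨l, hl, h, hh, e⟩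
    exact ⟨l⁻¹, L.inv_mem hl, h⁻¹, H.inv_mem hh, by rw [e]; group⟩
  · rintro x y z ⟨l, hl, h, hh, e⟩ ⟨l', hl', h', hh', e'⟩
    exact ⟨l' * l, L.mul_mem hl' hl, h * h', H.mul_mem hh hh', by rw [e', e]; group⟩

theorem IsDoubleCosetReps.nonempty {L K H : Subgroup G} {S : Finset K}
    (h : IsDoubleCosetReps L K H S) : S.Nonempty := by
  obtain ⟨s, hs, -⟩ := h 1
  exact ⟨s, hs.1⟩

theorem Coloring.exists_reps (H K : Subgroup G) :
    ∃ S : Finset (Coloring H K), IsTransversal Coloring.SameOrbit S := by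
  have : Finite (Coloring H K) := Finite.of_injective Coloring.toFun (by
    rintro ⟨f, _⟩ ⟨g, _⟩ (rfl : f = g); rfl)
  apply exists_transversal
  refine ⟨fun F => ⟨1, fun x => by rw [one_mul]⟩, ?_, ?_⟩
  · rintro F F' ⟨h, e⟩
    exact ⟨h⁻¹, fun x => by rw [← e, mul_inv_cancel_left]⟩
  · rintro F F' F'' ⟨h, e⟩ ⟨h', e'⟩
    exact ⟨h' * h, fun x => by rw [mul_assoc, e', e]⟩

theorem CosetSection.exists_reps (H K L : Subgroup G) :
    ∃ S : Finset (CosetSection H K L), IsTransversal CosetSection.SameOrbit S := by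
  have : Finite (CosetSection H K L) := Finite.of_injective CosetSection.toFun (by
    rintro ⟨f, _, _⟩ ⟨g, _, _⟩ (rfl : f = g); rfl)
  apply exists_transversal
  refine ⟨fun F => ⟨1, fun x => by simp⟩, ?_, ?_⟩
  · rintro F F' ⟨h, e⟩
    refine ⟨h⁻¹, fun x => ?_⟩
    have := L.inv_mem (e (h⁻¹ * x))
    simpa [mul_assoc] using this
  · rintro F F' F'' ⟨h, e⟩ ⟨h', e'⟩
    refine ⟨h' * h, fun x => ?_⟩
    have := L.mul_mem (e' (h * x)) (e x)
    simpa [mul_assoc] using this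

end Reps

namespace TambaraIdeal

variable {G : Type v} [Group G] [Finite G] {T : TambaraFunctor.{u, v} G}

theorem prod_mem_of_mem {R : Type u} [CommRing R] {ι : Type v} (I : Ideal R) (S : Finset ι)
    (f : ι → R) (i : ι) (hi : i ∈ S) (h : f i ∈ I) : ∏ j ∈ S, f j ∈ I :=
  Ideal.mem_of_dvd I (Finset.dvd_prod_of_mem f hi) h

/-- The levelwise sum of two Tambara ideals. -/
def add (I J : TambaraIdeal T) : TambaraIdeal T where
  level H := I.level H ⊔ J.level H
  res_mem h x hx := by
    obtain ⟨a, ha, b, hb, rfl⟩ := Submodule.mem_sup.1 hx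
    rw [map_add]
    exact Submodule.add_mem_sup (I.res_mem h a ha) (J.res_mem h b hb)
  tr_mem h x hx := by
    obtain ⟨a, ha, b, hb, rfl⟩ := Submodule.mem_sup.1 hx
    rw [map_add]
    exact Submodule.add_mem_sup (I.tr_mem h a ha) (J.tr_mem h b hb)
  norm_mem {K H} h x hx := by
    obtain ⟨a, ha, b, hb, rfl⟩ := Submodule.mem_sup.1 hx
    obtain ⟨S, hS⟩ := Coloring.exists_reps H K
    choose D hD using fun F : Coloring H K => exists_doubleCosetReps F.stab H K
    rw [T.norm_add h S hS D (fun F _ => hD F)]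
    refine Ideal.sum_mem _ fun F _ => ?_
    obtain ⟨γ, hγ⟩ := (hD F).nonempty
    cases hF : F.toFun γ
    · refine Submodule.mem_sup_right (J.tr_mem _ _ (prod_mem_of_mem _ _ _ γ hγ ?_))
      rw [hF]
      exact J.norm_mem _ _ (J.res_mem _ _ (J.conj_mem _ _ _ hb))
    · refine Submodule.mem_sup_left (I.tr_mem _ _ (prod_mem_of_mem _ _ _ γ hγ ?_))
      rw [hF]
      exact I.norm_mem _ _ (I.res_mem _ _ (I.conj_mem _ _ _ ha))
  conj_image := T.conj_image_eq (fun H => ((I.level H ⊔ J.level H : Ideal (T.obj H)) : Set _))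
    (fun g _ _ e x hx => by
      obtain ⟨a, ha, b, hb, rfl⟩ := Submodule.mem_sup.1 hx
      rw [map_add]
      exact Submodule.add_mem_sup (I.conj_mem g e a ha) (J.conj_mem g e b hb))

section Trace

variable (X : ∀ H : Subgroup G, Set (T.obj H))

/-- Finite sums of transfers of elements of `X`. -/
def traceSpan (H : Subgroup G) : AddSubmonoid (T.obj H) :=
  AddSubmonoid.closure {y | ∃ (L : Subgroup G) (h : L ≤ H) (x : T.obj L), x ∈ X L ∧ T.tr h x = y}

variable {X}

theorem tr_mem_traceSpan {L H : Subgroup G} (h : L ≤ H) {x : T.obj L} (hx : x ∈ X L) :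
    T.tr h x ∈ traceSpan X H :=
  AddSubmonoid.subset_closure ⟨L, h, x, hx, rfl⟩

theorem traceSpan_smul (hmul : ∀ H (c x : T.obj H), x ∈ X H → c * x ∈ X H)
    {H : Subgroup G} (c x : T.obj H) (hx : x ∈ traceSpan X H) : c * x ∈ traceSpan X H := by
  induction hx using AddSubmonoid.closure_induction with
  | mem x hx =>
    obtain ⟨L, h, x, hx, rfl⟩ := hx
    rw [← T.tr_res_mul]
    exact tr_mem_traceSpan h (hmul _ _ _ hx)
  | zero => rw [mul_zero]; exact zero_mem _
  | add x y _ _ hx hy => rw [mul_add]; exact add_mem hx hy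

theorem traceSpan_tr {K H : Subgroup G} (h : K ≤ H) (x : T.obj K) (hx : x ∈ traceSpan X K) :
    T.tr h x ∈ traceSpan X H := by
  induction hx using AddSubmonoid.closure_induction with
  | mem x hx =>
    obtain ⟨L, h', x, hx, rfl⟩ := hx
    rw [T.tr_tr]
    exact tr_mem_traceSpan _ hx
  | zero => rw [map_zero]; exact zero_mem _
  | add x y _ _ hx hy => rw [map_add]; exact add_mem hx hy

theorem traceSpan_conj
    (hconj : ∀ (g : G) {H K : Subgroup G} (e : K = conjSubgroup g H) (x : T.obj H),
      x ∈ X H → T.conj g e x ∈ X K)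
    (g : G) {H K : Subgroup G} (e : K = conjSubgroup g H) (x : T.obj H)
    (hx : x ∈ traceSpan X H) : T.conj g e x ∈ traceSpan X K := by
  induction hx using AddSubmonoid.closure_induction with
  | mem x hx =>
    obtain ⟨L, h', x, hx, rfl⟩ := hx
    rw [T.conj_tr g h' (K' := conjSubgroup g L) (by rw [e]; exact Subgroup.map_mono h') rfl e]
    exact tr_mem_traceSpan _ (hconj _ _ _ hx)
  | zero => rw [map_zero]; exact zero_mem _
  | add x y _ _ hx hy => rw [map_add]; exact add_mem hx hy

theorem traceSpan_res
    (hconj : ∀ (g : G) {H K : Subgroup G} (e : K = conjSubgroup g H) (x : T.obj H),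
      x ∈ X H → T.conj g e x ∈ X K)
    (hres : ∀ {K H : Subgroup G} (h : K ≤ H) (x : T.obj H), x ∈ X H → T.res h x ∈ X K)
    {K H : Subgroup G} (h : K ≤ H) (x : T.obj H) (hx : x ∈ traceSpan X H) :
    T.res h x ∈ traceSpan X K := by
  induction hx using AddSubmonoid.closure_induction with
  | mem x hx =>
    obtain ⟨L, h', x, hx, rfl⟩ := hx
    obtain ⟨S, hS⟩ := exists_doubleCosetReps K _ L
    rw [T.res_tr h' h S hS]
    exact sum_mem fun γ _ => tr_mem_traceSpan _ (hres _ _ (hconj _ _ _ hx))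
  | zero => rw [map_zero]; exact zero_mem _
  | add x y _ _ hx hy => rw [map_add]; exact add_mem hx hy

theorem norm_res_conj {H K S : Subgroup G} (h : K ≤ H) (hS : S = H) (γ : H) (x : T.obj K) :
    ∃ e : S = conjSubgroup (γ : G) H,
      T.norm (inf_le_left : S ⊓ conjSubgroup (γ : G) K ≤ S)
        (T.res inf_le_right (T.conj (γ : G) rfl x)) = T.conj (γ : G) e (T.norm h x) := by
  have eH : H = conjSubgroup (γ : G) H := by
    ext z
    constructor
    · intro hz
      exact ⟨(γ : G)⁻¹ * z * γ, H.mul_mem (H.mul_mem (H.inv_mem γ.2) hz) γ.2, by simp [mul_assoc]⟩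
    · rintro ⟨w, hw, rfl⟩
      exact H.mul_mem (H.mul_mem γ.2 hw) (H.inv_mem γ.2)
  subst hS
  have eW : S ⊓ conjSubgroup (γ : G) K = conjSubgroup (γ : G) K :=
    inf_eq_right.2 ((Subgroup.map_mono h).trans eH.ge)
  refine ⟨eH, ?_⟩
  rw [T.conj_norm (γ : G) h inf_le_left eW eH]
  congr 1
  have := T.conj_res (γ : G) (_root_.le_refl K) (inf_le_right : S ⊓ conjSubgroup (γ : G) K ≤ _)
    eW rfl x
  rw [← this, T.res_refl]

theorem traceSpan_norm
    (hmul : ∀ H (c x : T.obj H), x ∈ X H → c * x ∈ X H)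
    (hconj : ∀ (g : G) {H K : Subgroup G} (e : K = conjSubgroup g H) (x : T.obj H),
      x ∈ X H → T.conj g e x ∈ X K)
    (hres : ∀ {K H : Subgroup G} (h : K ≤ H) (x : T.obj H), x ∈ X H → T.res h x ∈ X K)
    (hnorm : ∀ {K H : Subgroup G} (h : K ≤ H) (x : T.obj K), x ∈ X K → T.norm h x ∈ X H)
    (hzero : ∀ H, (0 : T.obj H) ∈ X H)
    (H : Subgroup G) : ∀ {K : Subgroup G} (h : K ≤ H) (x : T.obj K), x ∈ traceSpan X K →
      T.norm h x ∈ traceSpan X H := by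
  induction H using WellFoundedLT.induction with
  | ind H ih =>
  intro K h x hx
  induction hx using AddSubmonoid.closure_induction with
  | mem x hx =>
    obtain ⟨L, h', x, hx, rfl⟩ := hx
    obtain ⟨S, hS⟩ := CosetSection.exists_reps H K L
    choose D hD using fun F : CosetSection H K L => exists_doubleCosetReps F.stab H K
    rw [T.norm_tr h' h S hS D (fun F _ => hD F)]
    refine sum_mem fun F _ => tr_mem_traceSpan _ ?_
    obtain ⟨γ, hγ⟩ := (hD F).nonempty
    obtain ⟨c, hc⟩ := Finset.dvd_prod_of_mem (fun γ : H => T.norm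
      (inf_le_left : F.stab ⊓ conjSubgroup (γ : G) K ≤ F.stab)
        (T.res (F.stab_inf_le γ) (T.conj (F.toFun γ : G) rfl x))) hγ
    rw [hc, mul_comm]
    exact hmul _ _ _ (hnorm _ _ (hres _ _ (hconj _ _ _ hx)))
  | zero =>
    have : T.norm h 0 ∈ X H := hnorm h 0 (hzero K)
    rw [← T.tr_refl (T.norm h 0)]
    exact tr_mem_traceSpan _ this
  | add x y hx hy hx' hy' =>
    obtain ⟨S, hS⟩ := Coloring.exists_reps H K
    choose D hD using fun F : Coloring H K => exists_doubleCosetReps F.stab H K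
    rw [T.norm_add h S hS D (fun F _ => hD F)]
    refine sum_mem fun F _ => traceSpan_tr _ _ ?_
    obtain ⟨γ, hγ⟩ := (hD F).nonempty
    obtain ⟨c, hc⟩ := Finset.dvd_prod_of_mem (fun γ : H => T.norm
      (inf_le_left : F.stab ⊓ conjSubgroup (γ : G) K ≤ F.stab)
        (T.res inf_le_right (T.conj (γ : G) rfl (bif F.toFun γ then x else y)))) hγ
    rw [hc, mul_comm]
    refine traceSpan_smul hmul _ _ ?_
    have hz : (bif F.toFun γ then x else y) ∈ traceSpan X K ∧
        T.norm h (bif F.toFun γ then x else y) ∈ traceSpan X H := by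
      cases F.toFun γ
      · exact ⟨hy, hy'⟩
      · exact ⟨hx, hx'⟩
    rcases F.stab_le.lt_or_eq with hlt | heq
    · exact ih _ hlt _ _ (traceSpan_res hconj hres _ _ (traceSpan_conj hconj _ _ _ hz.1))
    · obtain ⟨e, he⟩ := norm_res_conj h heq γ (bif F.toFun γ then x else y)
      change T.norm (inf_le_left : F.stab ⊓ conjSubgroup (γ : G) K ≤ F.stab) _ ∈ _
      rw [he]
      exact traceSpan_conj hconj _ _ _ hz.2

end Trace

/-- Sums of transfers of `n`-fold products of elements of `I`, for `n ≥ 1`. -/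
def tracePow (I : TambaraIdeal T) (n : ℕ) : TambaraIdeal T :=
  let X : ∀ H : Subgroup G, Set (T.obj H) := fun H =>
    {x | ∃ f : Fin (n + 1) → T.obj H, (∀ i, f i ∈ I.level H) ∧ x = ∏ i, f i}
  have hmul : ∀ H (c x : T.obj H), x ∈ X H → c * x ∈ X H := by
    rintro H c _ ⟨f, hf, rfl⟩
    refine ⟨Fin.cons (c * f 0) (fun i => f i.succ), fun i => ?_, ?_⟩
    · refine Fin.cases ?_ (fun i => ?_) i
      · exact Ideal.mul_mem_left _ _ (hf 0)
      · exact hf _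
    · rw [Fin.prod_univ_succ, Fin.prod_univ_succ]
      simp [mul_assoc]
  have hconj : ∀ (g : G) {H K : Subgroup G} (e : K = conjSubgroup g H) (x : T.obj H),
      x ∈ X H → T.conj g e x ∈ X K := by
    rintro g H K e _ ⟨f, hf, rfl⟩
    exact ⟨fun i => T.conj g e (f i), fun i => I.conj_mem _ _ _ (hf i), map_prod _ _ _⟩
  have hres : ∀ {K H : Subgroup G} (h : K ≤ H) (x : T.obj H), x ∈ X H → T.res h x ∈ X K := by
    rintro K H h _ ⟨f, hf, rfl⟩
    exact ⟨fun i => T.res h (f i), fun i => I.res_mem _ _ (hf i), map_prod _ _ _⟩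
  have hnorm : ∀ {K H : Subgroup G} (h : K ≤ H) (x : T.obj K), x ∈ X K → T.norm h x ∈ X H := by
    rintro K H h _ ⟨f, hf, rfl⟩
    exact ⟨fun i => T.norm h (f i), fun i => I.norm_mem _ _ (hf i), map_prod _ _ _⟩
  have hzero : ∀ H, (0 : T.obj H) ∈ X H := fun H =>
    ⟨fun _ => 0, fun _ => zero_mem _, by simp⟩
  { level := fun H =>
      { traceSpan X H with
        smul_mem' := fun c x hx => traceSpan_smul hmul c x hx }
    res_mem := fun h x hx => traceSpan_res hconj hres h x hx
    tr_mem := fun h x hx => traceSpan_tr h x hx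
    norm_mem := fun h x hx => traceSpan_norm hmul hconj hres hnorm hzero _ h x hx
    conj_image := T.conj_image_eq (fun H => (traceSpan X H : Set _))
      (fun g _ _ e x hx => traceSpan_conj hconj g e x hx) }

theorem tracePow_le {I J : TambaraIdeal T} {n : ℕ}
    (h : ∀ H, I.level H ^ (n + 1) ≤ J.level H) : I.tracePow n ≤ J := by
  intro H x hx
  refine AddSubmonoid.closure_induction (motive := fun y _ => y ∈ J.level H) ?_ (zero_mem _)
    (fun _ _ _ _ => add_mem) hx
  rintro _ ⟨L, hL, _, ⟨f, hf, rfl⟩, rfl⟩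
  refine J.tr_mem _ _ (h L ?_)
  simpa using Ideal.prod_mem_prod (s := Finset.univ) (I := fun _ => I.level L) (fun i _ => hf i)

theorem ipow_le_tracePow (I : TambaraIdeal T) (n : ℕ) : I.ipow (n + 1) ≤ I.tracePow n := by
  induction n with
  | zero =>
    intro H x hx
    change x ∈ traceSpan _ H
    rw [← T.tr_refl x]
    exact tr_mem_traceSpan _ ⟨fun _ => x, fun _ => hx, by simp⟩
  | succ n ih =>
    refine mul_le fun H => Ideal.mul_le.2 fun u hu a ha => ?_
    have hu' := ih H hu
    refine AddSubmonoid.closure_induction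
      (motive := fun u _ => u * a ∈ (I.tracePow (n + 1)).level H) ?_ ?_ ?_ hu'
    · rintro _ ⟨L, hL, _, ⟨f, hf, rfl⟩, rfl⟩
      rw [mul_comm, ← T.tr_res_mul]
      refine tr_mem_traceSpan hL ⟨Fin.cons (T.res hL a) f, fun i => ?_, ?_⟩
      · refine Fin.cases ?_ (fun i => ?_) i
        · exact I.res_mem hL a ha
        · exact hf i
      · simp [Fin.prod_univ_succ]
    · rw [zero_mul]; exact zero_mem _
    · intro x y _ _ hx hy
      rw [add_mul]; exact add_mem hx hy

theorem ipow_le_iff {I J : TambaraIdeal T} {n : ℕ} :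
    I.ipow (n + 1) ≤ J ↔ ∀ H, I.level H ^ (n + 1) ≤ J.level H :=
  ⟨fun h H => (I.level_pow_le n H).trans (h H),
    fun h => le_trans' (I.ipow_le_tracePow n) (tracePow_le h)⟩

theorem ipow_le_of_le {I I' J : TambaraIdeal T} (h : I' ≤ I)
    (hn : ∃ n, 1 ≤ n ∧ I.ipow n ≤ J) : ∃ n, 1 ≤ n ∧ I'.ipow n ≤ J := by
  obtain ⟨_ | n, h1, hn⟩ := hn
  · omega
  · exact ⟨n + 1, h1, ipow_le_iff.2 fun H => (Ideal.pow_right_mono (h H) _).trans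
      (ipow_le_iff.1 hn H)⟩

/-- The radical of a Tambara ideal: `x ∈ (√I)(G/H)` iff `⟨x⟩ⁿ ⊆ I` for some `n ≥ 1`. -/
def radical (I : TambaraIdeal T) : TambaraIdeal T where
  level H :=
    { carrier := {x : T.obj H | ∃ n, 1 ≤ n ∧ (principal x).ipow n ≤ I}
      zero_mem' := ⟨1, _root_.le_refl 1, principal_le (zero_mem _)⟩
      add_mem' := by
        rintro x y ⟨_ | n, hn, hx⟩ ⟨_ | m, hm, hy⟩
        any_goals omega
        refine ipow_le_of_le (I := (principal x).add (principal y))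
          (principal_le (Submodule.add_mem_sup (mem_principal x) (mem_principal y)))
          ⟨(n + 1 + m) + 1, by omega, ipow_le_iff.2 fun K => ?_⟩
        refine le_trans ?_ (sup_le (ipow_le_iff.1 hx K) (ipow_le_iff.1 hy K))
        exact (Ideal.sup_pow_add_le_pow_sup_pow (n := n + 1) (m := m + 1)).trans' le_rfl
      smul_mem' := fun c _ hx =>
        ipow_le_of_le (principal_le (Ideal.mul_mem_left _ c (mem_principal _))) hx }
  res_mem h x hx := ipow_le_of_le (principal_le (res_mem _ h _ (mem_principal x))) hx
  tr_mem h x hx := ipow_le_of_le (principal_le (tr_mem _ h _ (mem_principal x))) hx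
  norm_mem h x hx := ipow_le_of_le (principal_le (norm_mem _ h _ (mem_principal x))) hx
  conj_image := T.conj_image_eq (fun H => {x : T.obj H | ∃ n, 1 ≤ n ∧ (principal x).ipow n ≤ I})
    (fun g _ _ e x hx => ipow_le_of_le (principal_le (conj_mem _ g e _ (mem_principal x))) hx)

end TambaraIdeal

namespace TambaraIdeal

variable {G : Type v} [Group G] {T : TambaraFunctor.{u, v} G}

/-! As for commutative rings, everything comes down to comparing powers of `⟨x⟩`. Since `I * J` lies
in both `I` and `J`, an exponent that puts a power of `⟨x⟩` inside `I * J` also works for `I` and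
for `J`. Conversely, if `⟨x⟩ⁿ ≤ I` and `⟨x⟩ᵐ ≤ J`, then `⟨x⟩ⁿ⁺ᵐ ≤ I * J`, which is
`ipow_add_le_mul`.

The delicate point is the converse. A product of Tambara ideals is only the smallest Tambara ideal
above the levelwise products, and its levels can be larger than those products. Powers are moreover
bracketed to the left, so splitting `⟨x⟩ⁿ⁺ᵐ` as `⟨x⟩ⁿ * ⟨x⟩ᵐ` would require associativity of this
product. The criterion `ipow_le_iff` avoids the issue: a positive power of `K` lies in a Tambara
ideal exactly when the ordinary ideal powers of the levels of `K` lie in its levels. Behind it is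
the fact that the sums of transfers of `n`-fold products of elements of `K` form a Tambara ideal;
Frobenius reciprocity shows that this ideal contains `Kⁿ`. With the criterion, the splitting takes
place in a single commutative ring `T(G/H)`, where exponents add as usual. -/

theorem mul_le_left (I J : TambaraIdeal T) : I * J ≤ I :=
  mul_le fun _ => Ideal.mul_le_left

theorem mul_le_right (I J : TambaraIdeal T) : I * J ≤ J :=
  mul_le fun _ => Ideal.mul_le_right

variable [Finite G]

/-- If a power of `K` lies in `I` and a power of `K` lies in `J`, then the power of `K` with the
sum of the exponents lies in `I * J`. -/
theorem ipow_add_le_mul {K I J : TambaraIdeal T} {n m : ℕ} (hn : 1 ≤ n) (hm : 1 ≤ m)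
    (hI : K.ipow n ≤ I) (hJ : K.ipow m ≤ J) : K.ipow (n + m) ≤ I * J := by
  -- `ipow_le_iff` speaks of exponents in successor form, so both exponents are written as
  -- successors; from here on `n` and `m` denote the predecessors.
  obtain ⟨n, rfl⟩ := Nat.exists_eq_add_of_le' hn
  obtain ⟨m, rfl⟩ := Nat.exists_eq_add_of_le' hm
  -- The exponent `(n + 1) + (m + 1)` is definitionally the successor of `n + 1 + m`, which is why
  -- the index is given explicitly.
  refine ipow_le_iff (n := n + 1 + m) |>.2 fun H => ?_
  -- Regrouping the exponent as `(n + 1) + (m + 1)` turns the ideal power at level `H` into a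
  -- product of two, one lying in `I.level H` and the other in `J.level H`.
  rw [add_assoc, pow_add]
  exact (Ideal.mul_mono (ipow_le_iff.1 hI H) (ipow_le_iff.1 hJ H)).trans (level_mul_le I J H)

end TambaraIdeal

theorem mainTheorem7 {G : Type v} [Group G] [Finite G] (T : TambaraFunctor.{u, v} G)
    (I J : TambaraIdeal T) :
    (I * J).radical = I.radical ⊓ J.radical := by
  ext H x
  constructor
  · rintro ⟨n, hn, h⟩
    -- One exponent serves both radicals.
    exact ⟨⟨n, hn, TambaraIdeal.le_trans' h (TambaraIdeal.mul_le_left I J)⟩,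
      ⟨n, hn, TambaraIdeal.le_trans' h (TambaraIdeal.mul_le_right I J)⟩⟩
  · rintro ⟨⟨n, hn, hI⟩, ⟨m, hm, hJ⟩⟩
    -- Here `K` is `principal x`, the same Tambara ideal in both hypotheses, so the exponents can be
    -- added.
    exact ⟨n + m, by omega, TambaraIdeal.ipow_add_le_mul hn hm hI hJ⟩
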